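/- Let $(M_1,g_1)$ and $(M_2,g_2)$ be connected smooth pseudo-Riemannian manifolds of dimensions $n_1\ge 2$ and $n_2\ge 2$, let $f\colon M_1\to(0,\infty)$ be smooth, and let $M=M_1\times_f M_2$ be the warped product, that is, $M_1\times M_2$ with the metric $g=\pi_1^*g_1+(f\circ\pi_1)^2\,\pi_2^*g_2$, where $\pi_i$ are the projections. Put $n=n_1+n_2$ and let $\tau$ be the scalar curvature of $(M,g)$. For a metric $h$ with Levi-Civita connection $\nabla$ write $R(X,Y)Z=\nabla_Y\nabla_XZ-\nabla_X\nabla_YZ+\nabla_{[X,Y]}Z$, with Ricci tensor $\mathrm{Ric}(X,Z)=\operatorname{tr}(Y\mapsto R(X,Y)Z)$ and scalar curvature the $h$-trace of $\mathrm{Ric}$; $h$ is said to be of constant curvature $c\in\mathbb R$ if $R(X,Y)Z=c\,[h(X,Z)Y-h(Y,Z)X]$ for all $X,Y,Z$. The concircular curvature tensor of $(M,g)$ is $$\mathcal C(X,Y)Z=R(X,Y)Z-\frac{\tau}{n(n-1)}\,[g(X,Z)Y-g(Y,Z)X],$$ and $M$ is called concircularly flat if $\mathcal C$ vanishes at every point.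 Let $\operatorname{grad}f$ and $H^f(Y,Z)=g_1(\nabla^1_Y\operatorname{grad}f,Z)$ be the gradient and the Hessian of $f$ on $(M_1,g_1)$, where $\nabla^1$ is the Levi-Civita connection of $g_1$, and let $\|\operatorname{grad}f\|_1^2=g_1(\operatorname{grad}f,\operatorname{grad}f)$. Then $M$ is concircularly flat if and only if $\kappa:=\dfrac{\tau}{n(n-1)}$ is constant on $M$ and 1. $M_1$ is of constant curvature $\kappa$; 2. $\dfrac1f H^f(Y,Z)+\kappa\,g_1(Y,Z)=0$ for all tangent vectors $Y,Z$ at the same point of $M_1$; and 3. the function $\kappa f^2+\|\operatorname{grad}f\|_1^2$ is constant on $M_1$, and $M_2$ is of constant curvature $\kappa_2=\kappa f^2+\|\operatorname{grad}f\|_1^2$. -/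

import Mathlib

open Set Module
open scoped Manifold ContDiff Topology

noncomputable section

/-! ### Tensor calculus in a coordinate domain

`G : E → (E →L[ℝ] E →L[ℝ] ℝ)` is the coordinate expression of a pseudo-Riemannian metric on an open
subset of the coordinate space `E`; vector fields on this open set are functions `E → E`. -/

namespace Coord

variable {E : Type*} [NormedAddCommGroup E] [NormedSpace ℝ E]

/-- The linear form `w ↦ (D_u G)(v, w) + (D_v G)(u, w) - (D_w G)(u, v)` at the point `y`
(twice the Christoffel symbols of the first kind). -/
def koszul (G : E → (E →L[ℝ] E →L[ℝ] ℝ)) (y u v : E) : E →L[ℝ] ℝ :=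
  fderiv ℝ G y u v + fderiv ℝ G y v u - ((fderiv ℝ G y).flip u).flip v

/-- The Christoffel symbols `Γ_y(u, v)` of the Levi-Civita connection of `G`:
`2 G_y(Γ_y(u, v), w) = (D_u G)(v, w) + (D_v G)(u, w) - (D_w G)(u, v)` for all `w`. -/
def christoffel (G : E → (E →L[ℝ] E →L[ℝ] ℝ)) (y u v : E) : E :=
  (1 / 2 : ℝ) • (G y).inverse (koszul G y u v)

/-- The Levi-Civita covariant derivative `∇_X Z` of vector fields in coordinates. -/
def nabla (G : E → (E →L[ℝ] E →L[ℝ] ℝ)) (X Z : E → E) (y : E) : E :=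
  fderiv ℝ Z y (X y) + christoffel G y (X y) (Z y)

/-- The curvature operator `R(X, Y)Z = ∇_Y ∇_X Z - ∇_X ∇_Y Z + ∇_[X,Y] Z` in coordinates. -/
def curvature (G : E → (E →L[ℝ] E →L[ℝ] ℝ)) (X Y Z : E → E) (y : E) : E :=
  nabla G Y (nabla G X Z) y - nabla G X (nabla G Y Z) y
    + nabla G (VectorField.lieBracket ℝ X Y) Z y

/-- The gradient in coordinates of a function `h`: `G_y(grad h, v) = dh_y(v)`. -/
def gradient (G : E → (E →L[ℝ] E →L[ℝ] ℝ)) (h : E → ℝ) (y : E) : E :=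
  (G y).inverse (fderiv ℝ h y)

end Coord

/-! ### Pseudo-Riemannian manifolds -/

section Manifold

variable {E : Type*} [NormedAddCommGroup E] [NormedSpace ℝ E]
  {H : Type*} [TopologicalSpace H] (I : ModelWithCorners ℝ E H)
  {M : Type*} [TopologicalSpace M] [ChartedSpace H M]

/-- The coordinate expression, in the chart around `x₀`, of a field `g` of bilinear forms on the
tangent spaces of `M`: the pullback of `g` by the inverse of the chart. -/
def chartCoeff (g : ∀ x : M, TangentSpace I x →L[ℝ] TangentSpace I x →L[ℝ] ℝ) (x₀ : M) (y : E) :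
    E →L[ℝ] E →L[ℝ] ℝ :=
  ContinuousLinearMap.bilinearComp (E := E) (F := E)
    (g ((extChartAt I x₀).symm y))
    (mfderiv 𝓘(ℝ, E) I (extChartAt I x₀).symm y : E →L[ℝ] E)
    (mfderiv 𝓘(ℝ, E) I (extChartAt I x₀).symm y : E →L[ℝ] E)

variable (M) in
/-- A smooth pseudo-Riemannian metric on a manifold (without boundary): a field of symmetric
nondegenerate bilinear forms on the tangent spaces, of arbitrary signature, whose components in
every chart of the atlas are smooth. -/
structure PseudoRiemannianMetric where
  /-- The bilinear form on the tangent space at `x`. -/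
  toFun (x : M) : TangentSpace I x →L[ℝ] TangentSpace I x →L[ℝ] ℝ
  symm (x : M) (u v : TangentSpace I x) : toFun x u v = toFun x v u
  nondegenerate (x : M) (u : TangentSpace I x) (h : ∀ v, toFun x u v = 0) : u = 0
  smooth (x₀ : M) : ContDiffOn ℝ ∞ (chartCoeff I toFun x₀) (extChartAt I x₀).target

namespace PseudoRiemannianMetric

variable {I} [FiniteDimensional ℝ E] (g : PseudoRiemannianMetric I M)

/-- The metric in the coordinates given by the chart around `x₀`. -/
def coeff (x₀ : M) : E → (E →L[ℝ] E →L[ℝ] ℝ) := chartCoeff I g.toFun x₀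

/-- The curvature tensor `R(u, v)w` at `x`. It is computed in the chart around `x`, which is also the
chart by which the tangent space at `x` is identified with `E`, by extending `u, v, w` to vector
fields with constant components. -/
def riemann (x : M) (u v w : TangentSpace I x) : TangentSpace I x :=
  Coord.curvature (E := E) (g.coeff x) (fun _ => u) (fun _ => v) (fun _ => w) (extChartAt I x x)

/-- The Ricci tensor: `Ric(u, v)` is the trace of `w ↦ R(u, w)v`. -/
def ricci (x : M) (u v : TangentSpace I x) : ℝ :=
  ∑ i, (finBasis ℝ E).repr (g.riemann x u (finBasis ℝ E i : E) v) i

/-- The scalar curvature `τ = ∑ g^{ij} Ric_{ij}`, where `(g^{ij})` is the inverse of the matrix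
of the metric in a basis of the tangent space. -/
def scalarCurvature (x : M) : ℝ :=
  ∑ i, ∑ j,
    (Matrix.of fun k l => g.toFun x (finBasis ℝ E k : E) (finBasis ℝ E l : E))⁻¹ i j *
      g.ricci x (finBasis ℝ E i : E) (finBasis ℝ E j : E)

/-- The function `τ / (n (n - 1))`, where `τ` is the scalar curvature and `n` the dimension. -/
def normalizedScalarCurvature (x : M) : ℝ :=
  g.scalarCurvature x / ((finrank ℝ E : ℝ) * ((finrank ℝ E : ℝ) - 1))

/-- The concircular curvature tensor
`C(u, v)w = R(u, v)w - τ / (n (n - 1)) (g(u, w) v - g(v, w) u)`. -/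
def concircular (x : M) (u v w : TangentSpace I x) : TangentSpace I x :=
  g.riemann x u v w
    - g.normalizedScalarCurvature x • (g.toFun x u w • v - g.toFun x v w • u)

/-- The concircular curvature tensor vanishes at every point. -/
def IsConcircularlyFlat : Prop :=
  ∀ (x : M) (u v w : TangentSpace I x), g.concircular x u v w = 0

/-- The manifold is of constant curvature `κ`: `R(u, v)w = κ (g(u, w) v - g(v, w) u)` at every
point. -/
def HasConstantCurvature (κ : ℝ) : Prop :=
  ∀ (x : M) (u v w : TangentSpace I x),
    g.riemann x u v w = κ • (g.toFun x u w • v - g.toFun x v w • u)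

/-- The gradient of `f : M → ℝ` at `x`: `g(grad f, v) = df(v)`. -/
def grad (f : M → ℝ) (x : M) : TangentSpace I x :=
  Coord.gradient (E := E) (g.coeff x) (f ∘ (extChartAt I x).symm) (extChartAt I x x)

/-- The squared length `g(grad f, grad f)` of the gradient; it may be negative when `g` is
indefinite. -/
def gradNormSq (f : M → ℝ) (x : M) : ℝ :=
  g.toFun x (g.grad f x) (g.grad f x)

/-- The Hessian `H^f(u, v) = g(∇_u grad f, v)`. -/
def hessian (f : M → ℝ) (x : M) (u v : TangentSpace I x) : ℝ :=
  g.toFun x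
    (Coord.nabla (E := E) (g.coeff x) (fun _ => u)
      (Coord.gradient (g.coeff x) (f ∘ (extChartAt I x).symm)) (extChartAt I x x) : E) v

end PseudoRiemannianMetric

end Manifold

/-! ### Warped products -/

section Warped

variable {E₁ : Type*} [NormedAddCommGroup E₁] [NormedSpace ℝ E₁]
  {H₁ : Type*} [TopologicalSpace H₁] {I₁ : ModelWithCorners ℝ E₁ H₁}
  {M₁ : Type*} [TopologicalSpace M₁] [ChartedSpace H₁ M₁]
  {E₂ : Type*} [NormedAddCommGroup E₂] [NormedSpace ℝ E₂]
  {H₂ : Type*} [TopologicalSpace H₂] {I₂ : ModelWithCorners ℝ E₂ H₂}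
  {M₂ : Type*} [TopologicalSpace M₂] [ChartedSpace H₂ M₂]

/-- The bilinear form `a ⊕ c b` on `E₁ × E₂`. -/
def orthSum (a : E₁ →L[ℝ] E₁ →L[ℝ] ℝ) (c : ℝ) (b : E₂ →L[ℝ] E₂ →L[ℝ] ℝ) :
    (E₁ × E₂) →L[ℝ] (E₁ × E₂) →L[ℝ] ℝ :=
  a.bilinearComp (ContinuousLinearMap.fst ℝ E₁ E₂) (ContinuousLinearMap.fst ℝ E₁ E₂)
    + c • b.bilinearComp (ContinuousLinearMap.snd ℝ E₁ E₂) (ContinuousLinearMap.snd ℝ E₁ E₂)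

/-- The field of bilinear forms `π₁^* g₁ + (f ∘ π₁)² π₂^* g₂` on `M₁ × M₂`. The tangent space of
`M₁ × M₂` at `(p, q)` is the product of the tangent spaces, and the differentials of the projections
are the linear projections. -/
def warpedForm (g₁ : PseudoRiemannianMetric I₁ M₁) (g₂ : PseudoRiemannianMetric I₂ M₂)
    (f : M₁ → ℝ) (x : M₁ × M₂) :
    TangentSpace (I₁.prod I₂) x →L[ℝ] TangentSpace (I₁.prod I₂) x →L[ℝ] ℝ :=
  orthSum (E₁ := E₁) (E₂ := E₂) (g₁.toFun x.1) (f x.1 ^ 2) (g₂.toFun x.2)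

theorem contDiffOn_smul_real {E F : Type*} [NormedAddCommGroup E] [NormedSpace ℝ E]
    [NormedAddCommGroup F] [NormedSpace ℝ F] {s : Set E} {c : E → ℝ} {B : E → F}
    (hc : ContDiffOn ℝ ∞ c s) (hB : ContDiffOn ℝ ∞ B s) :
    ContDiffOn ℝ ∞ (fun y => c y • B y) s := hc.smul hB

theorem contDiffOn_bilinearComp {E F : Type*} [NormedAddCommGroup E] [NormedSpace ℝ E]
    [NormedAddCommGroup F] [NormedSpace ℝ F] {s : Set F} {B : F → (E₁ →L[ℝ] E₁ →L[ℝ] ℝ)}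
    (hB : ContDiffOn ℝ ∞ B s) (L : E →L[ℝ] E₁) :
    ContDiffOn ℝ ∞ (fun y => (B y).bilinearComp L L) s := by
  have h1 : ContDiffOn ℝ ∞ (fun y => (B y).comp L) s := hB.clm_comp contDiffOn_const
  have f1 := ContinuousLinearEquiv.contDiff (𝕜 := ℝ) (n := ∞) (E := E →L[ℝ] E₁ →L[ℝ] ℝ)
    (F := E₁ →L[ℝ] E →L[ℝ] ℝ) (ContinuousLinearMap.flipₗᵢ ℝ E E₁ ℝ).toContinuousLinearEquiv
  have f2 := ContinuousLinearEquiv.contDiff (𝕜 := ℝ) (n := ∞) (E := E →L[ℝ] E →L[ℝ] ℝ)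
    (F := E →L[ℝ] E →L[ℝ] ℝ) (ContinuousLinearMap.flipₗᵢ ℝ E E ℝ).toContinuousLinearEquiv
  have h2 : ContDiffOn ℝ ∞ (fun y => ((B y).comp L).flip) s := f1.comp_contDiffOn h1
  have h3 : ContDiffOn ℝ ∞ (fun y => ((B y).comp L).flip.comp L) s :=
    h2.clm_comp contDiffOn_const
  exact f2.comp_contDiffOn h3

theorem chartCoeff_warpedForm [I₁.Boundaryless] [IsManifold I₁ ∞ M₁]
    [I₂.Boundaryless] [IsManifold I₂ ∞ M₂]
    (g₁ : PseudoRiemannianMetric I₁ M₁) (g₂ : PseudoRiemannianMetric I₂ M₂)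
    (f : M₁ → ℝ) (x₀ : M₁ × M₂) (y : E₁ × E₂)
    (hy : y ∈ (extChartAt (I₁.prod I₂) x₀).target) :
    chartCoeff (I₁.prod I₂) (warpedForm g₁ g₂ f) x₀ y =
      orthSum (chartCoeff I₁ g₁.toFun x₀.1 y.1) (f ((extChartAt I₁ x₀.1).symm y.1) ^ 2)
        (chartCoeff I₂ g₂.toFun x₀.2 y.2) := by
  have hy1 : y.1 ∈ (extChartAt I₁ x₀.1).target := by
    rw [extChartAt_prod] at hy; exact hy.1
  have hy2 : y.2 ∈ (extChartAt I₂ x₀.2).target := by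
    rw [extChartAt_prod] at hy; exact hy.2
  have d1 : MDifferentiableAt 𝓘(ℝ, E₁) I₁ (extChartAt I₁ x₀.1).symm y.1 :=
    ((contMDiffOn_extChartAt_symm (I := I₁) (n := ∞) x₀.1).contMDiffAt
      ((isOpen_extChartAt_target x₀.1).mem_nhds hy1)).mdifferentiableAt (by simp)
  have d2 : MDifferentiableAt 𝓘(ℝ, E₂) I₂ (extChartAt I₂ x₀.2).symm y.2 :=
    ((contMDiffOn_extChartAt_symm (I := I₂) (n := ∞) x₀.2).contMDiffAt
      ((isOpen_extChartAt_target x₀.2).mem_nhds hy2)).mdifferentiableAt (by simp)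
  have key : (mfderiv 𝓘(ℝ, E₁ × E₂) (I₁.prod I₂) (extChartAt (I₁.prod I₂) x₀).symm y :
      (E₁ × E₂) →L[ℝ] (E₁ × E₂)) =
      ContinuousLinearMap.prodMap
        (mfderiv 𝓘(ℝ, E₁) I₁ (extChartAt I₁ x₀.1).symm y.1 : E₁ →L[ℝ] E₁)
        (mfderiv 𝓘(ℝ, E₂) I₂ (extChartAt I₂ x₀.2).symm y.2 : E₂ →L[ℝ] E₂) := by
    have e : ((extChartAt (I₁.prod I₂) x₀).symm : E₁ × E₂ → M₁ × M₂) =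
        Prod.map (extChartAt I₁ x₀.1).symm (extChartAt I₂ x₀.2).symm := by
      rw [extChartAt_prod]; rfl
    have h := mfderiv_prodMap d1 d2
    rw [← modelWithCornersSelf_prod, chartedSpaceSelf_prod] at h
    rw [e]
    exact h
  unfold chartCoeff
  rw [key, extChartAt_prod]
  rfl

/-- The warped product metric `g₁ ⊕ f² g₂` on `M₁ × M₂`, for a smooth function `f > 0` on `M₁`. -/
def warpedProduct [I₁.Boundaryless] [IsManifold I₁ ∞ M₁] [I₂.Boundaryless] [IsManifold I₂ ∞ M₂]
    (g₁ : PseudoRiemannianMetric I₁ M₁) (g₂ : PseudoRiemannianMetric I₂ M₂)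
    (f : M₁ → ℝ) (hf : ContMDiff I₁ 𝓘(ℝ, ℝ) ∞ f) (hpos : ∀ p, 0 < f p) :
    PseudoRiemannianMetric (I₁.prod I₂) (M₁ × M₂) where
  toFun := warpedForm g₁ g₂ f
  symm x u v := by
    change g₁.toFun x.1 u.1 v.1 + f x.1 ^ 2 * g₂.toFun x.2 u.2 v.2 =
      g₁.toFun x.1 v.1 u.1 + f x.1 ^ 2 * g₂.toFun x.2 v.2 u.2
    exact congrArg₂ (fun a b => a + f x.1 ^ 2 * b) (g₁.symm x.1 _ _) (g₂.symm x.2 _ _)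
  nondegenerate x u h := by
    have h' : ∀ (v₁ : E₁) (v₂ : E₂),
        g₁.toFun x.1 u.1 v₁ + f x.1 ^ 2 * g₂.toFun x.2 u.2 v₂ = 0 := fun v₁ v₂ => h (v₁, v₂)
    refine Prod.ext (g₁.nondegenerate x.1 u.1 fun v => ?_) (g₂.nondegenerate x.2 u.2 fun v => ?_)
    · have h0 : g₂.toFun x.2 u.2 (0 : E₂) = 0 := map_zero (g₂.toFun x.2 u.2)
      have := h' v 0
      rw [h0] at this
      linarith
    · have h0 : g₁.toFun x.1 u.1 (0 : E₁) = 0 := map_zero (g₁.toFun x.1 u.1)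
      have := h' 0 v
      rw [h0, zero_add] at this
      exact (mul_eq_zero.1 this).resolve_left (pow_ne_zero 2 (hpos x.1).ne')
  smooth x₀ := by
    refine ContDiffOn.congr ?_ (fun y hy => chartCoeff_warpedForm g₁ g₂ f x₀ y hy)
    have m1 : MapsTo (Prod.fst : E₁ × E₂ → E₁) (extChartAt (I₁.prod I₂) x₀).target
        (extChartAt I₁ x₀.1).target := by
      rw [extChartAt_prod]; exact fun y hy => hy.1
    have m2 : MapsTo (Prod.snd : E₁ × E₂ → E₂) (extChartAt (I₁.prod I₂) x₀).target
        (extChartAt I₂ x₀.2).target := by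
      rw [extChartAt_prod]; exact fun y hy => hy.2
    have c1 := (g₁.smooth x₀.1).comp contDiff_fst.contDiffOn m1
    have c2 := (g₂.smooth x₀.2).comp contDiff_snd.contDiffOn m2
    have cf : ContDiffOn ℝ ∞ (f ∘ (extChartAt I₁ x₀.1).symm) (extChartAt I₁ x₀.1).target :=
      (hf.comp_contMDiffOn (contMDiffOn_extChartAt_symm x₀.1)).contDiffOn
    have cf' := cf.comp contDiff_fst.contDiffOn m1
    have s1 := contDiffOn_bilinearComp c1 (ContinuousLinearMap.fst ℝ E₁ E₂)
    have s2 := contDiffOn_bilinearComp c2 (ContinuousLinearMap.snd ℝ E₁ E₂)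
    have s3 := contDiffOn_smul_real (F := (E₁ × E₂) →L[ℝ] (E₁ × E₂) →L[ℝ] ℝ) (cf'.pow 2) s2
    exact s1.add s3

end Warped

end

/-! In a product chart the curvature of g₁ ⊕ f² g₂ splits into a horizontal, a mixed and a vertical
part, given by R₁, by the Hessian of f, and by R₂ together with ‖grad f‖². Let k denote τ/(n(n-1)),
a priori a function on M. Concircular flatness says R(X,Y)Z = k [g(X,Z)Y - g(Y,Z)X] pointwise, and
this is equivalent to three pointwise conditions: R₁ has the constant curvature form with factor k,
H^f = -k f g₁, and R₂ has that form with factor k f² + ‖grad f‖² (`riemann_warpedProduct_eq_iff`).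
The scalar curvature is never computed; it enters only as the function k.

What remains is to show that k is constant. For fixed p the first condition determines k(p, q) from
data on M₁, because n₁ ≥ 2, so k does not depend on q. For fixed q the third condition makes k f² +
‖grad f‖² independent of p, because n₂ ≥ 2 (both by `eq_of_smul_curvatureForm_eq`). Differentiating,
the Hessian condition gives d‖grad f‖² = -2 k f df, hence f² dk = 0, and connectedness of M₁
concludes (`apply_eq_of_hessian_eq`). Neither the Bianchi identity nor Schur's lemma is used. -/

noncomputable section

/-! ### Levi-Civita connection, gradient and Hessian in coordinates -/

namespace Coord

variable {E : Type*} [NormedAddCommGroup E] [NormedSpace ℝ E]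

/-- The coordinate expression of a pseudo-Riemannian metric on an open set. -/
structure IsMetricOn (G : E → (E →L[ℝ] E →L[ℝ] ℝ)) (U : Set E) : Prop where
  isOpen : IsOpen U
  contDiffOn : ContDiffOn ℝ ∞ G U
  symm : ∀ y ∈ U, ∀ u v, G y u v = G y v u
  isInvertible : ∀ y ∈ U, (G y).IsInvertible

theorem isInvertible_of_nondegenerate [FiniteDimensional ℝ E] (B : E →L[ℝ] E →L[ℝ] ℝ)
    (h : ∀ u, (∀ v, B u v = 0) → u = 0) : B.IsInvertible := by
  have hinj : Function.Injective B.toLinearMap :=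
    (injective_iff_map_eq_zero B.toLinearMap).2 fun u hu => h u fun v => by
      have : B u = 0 := hu
      rw [this]; rfl
  have hfr : finrank ℝ E = finrank ℝ (E →L[ℝ] ℝ) := by
    rw [← LinearEquiv.finrank_eq (LinearMap.toContinuousLinearMap (𝕜 := ℝ) (E := E) (F' := ℝ))]
    exact (Subspace.dual_finrank_eq (K := ℝ) (V := E)).symm
  exact ⟨(LinearEquiv.ofInjectiveOfFinrankEq B.toLinearMap hinj hfr).toContinuousLinearEquiv,
    by ext u v; rfl⟩

theorem contDiffAt_flip {X F K : Type*} [NormedAddCommGroup X] [NormedSpace ℝ X]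
    [NormedAddCommGroup F] [NormedSpace ℝ F] [NormedAddCommGroup K] [NormedSpace ℝ K]
    {B : X → E →L[ℝ] F →L[ℝ] K} {x : X} (hB : ContDiffAt ℝ ∞ B x) :
    ContDiffAt ℝ ∞ (fun z => (B z).flip) x := by
  have h := ContinuousLinearEquiv.contDiff (𝕜 := ℝ) (n := ∞) (E := E →L[ℝ] F →L[ℝ] K)
    (F := F →L[ℝ] E →L[ℝ] K) (ContinuousLinearMap.flipₗᵢ ℝ E F K).toContinuousLinearEquiv
  exact h.contDiffAt.comp x hB

theorem contDiffAt_fderiv {F : Type*} [NormedAddCommGroup F] [NormedSpace ℝ F] {h : E → F} {y : E}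
    (hh : ContDiffAt ℝ ∞ h y) : ContDiffAt ℝ ∞ (fderiv ℝ h) y :=
  hh.fderiv_right (by simp)

namespace IsMetricOn

variable {G : E → (E →L[ℝ] E →L[ℝ] ℝ)} {U : Set E} {y : E}

theorem contDiffAt (hG : IsMetricOn G U) (hy : y ∈ U) : ContDiffAt ℝ ∞ G y :=
  hG.contDiffOn.contDiffAt (hG.isOpen.mem_nhds hy)

theorem differentiableAt (hG : IsMetricOn G U) (hy : y ∈ U) : DifferentiableAt ℝ G y :=
  (hG.contDiffAt hy).differentiableAt (by simp)

theorem hasFDerivAt_apply₂ (hG : IsMetricOn G U) (hy : y ∈ U) (v w : E) :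
    HasFDerivAt (fun z => G z v w) (((fderiv ℝ G y).flip v).flip w) y := by
  have h := ((hG.differentiableAt hy).hasFDerivAt.clm_apply (hasFDerivAt_const v y)).clm_apply
    (hasFDerivAt_const w y)
  convert! h using 1
  ext u; simp

theorem fderiv_apply₂ (hG : IsMetricOn G U) (hy : y ∈ U) (u v w : E) :
    fderiv ℝ (fun z => G z v w) y u = fderiv ℝ G y u v w := by
  rw [(hG.hasFDerivAt_apply₂ hy v w).fderiv]; rfl

theorem fderiv_symm (hG : IsMetricOn G U) (hy : y ∈ U) (u v w : E) :
    fderiv ℝ G y u v w = fderiv ℝ G y u w v := by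
  rw [← hG.fderiv_apply₂ hy, ← hG.fderiv_apply₂ hy]
  have : (fun z => G z v w) =ᶠ[𝓝 y] fun z => G z w v := by
    filter_upwards [hG.isOpen.mem_nhds hy] with z hz using hG.symm z hz v w
  rw [this.fderiv_eq]

/-- Nondegeneracy makes the Koszul identity characterize the Christoffel symbol. The algebraic rules
below and the warped product formula are all obtained by testing this identity against `w`, without
handling `inverse`, which is meaningful only where `G y` is invertible. -/
theorem christoffel_eq (hG : IsMetricOn G U) (hy : y ∈ U) {u v z : E}
    (h : ∀ w, 2 * G y z w = koszul G y u v w) : christoffel G y u v = z := by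
  unfold christoffel
  have : koszul G y u v = G y ((2 : ℝ) • z) := by
    ext w; rw [← h w]; simp
  rw [this, (hG.isInvertible y hy).inverse_apply_self, smul_smul]; norm_num

theorem apply_christoffel (hG : IsMetricOn G U) (hy : y ∈ U) (u v w : E) :
    2 * G y (christoffel G y u v) w = koszul G y u v w := by
  unfold christoffel
  rw [map_smul, (hG.isInvertible y hy).self_apply_inverse]; simp

theorem christoffel_symm (hG : IsMetricOn G U) (hy : y ∈ U) (u v : E) :
    christoffel G y u v = christoffel G y v u :=
  hG.christoffel_eq hy fun w => by
    rw [hG.apply_christoffel hy]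
    simp only [koszul, add_apply, sub_apply,
      ContinuousLinearMap.flip_apply, hG.fderiv_symm hy w u v]
    ring

theorem christoffel_add_right (hG : IsMetricOn G U) (hy : y ∈ U) (u v w : E) :
    christoffel G y u (v + w) = christoffel G y u v + christoffel G y u w :=
  hG.christoffel_eq hy fun x => by
    rw [map_add, add_apply, mul_add, hG.apply_christoffel hy,
      hG.apply_christoffel hy]
    simp only [koszul, map_add, add_apply, sub_apply,
      ContinuousLinearMap.flip_apply]
    ring

theorem christoffel_smul_right (hG : IsMetricOn G U) (hy : y ∈ U) (u v : E) (c : ℝ) :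
    christoffel G y u (c • v) = c • christoffel G y u v :=
  hG.christoffel_eq hy fun x => by
    rw [map_smul, smul_apply, smul_eq_mul, mul_left_comm,
      hG.apply_christoffel hy]
    simp only [koszul, map_smul, add_apply, sub_apply,
      ContinuousLinearMap.flip_apply, smul_apply, smul_eq_mul]
    ring

/-- The Levi-Civita connection is compatible with the metric. -/
theorem fderiv_eq_christoffel (hG : IsMetricOn G U) (hy : y ∈ U) (u v w : E) :
    fderiv ℝ G y u v w = G y (christoffel G y u v) w + G y v (christoffel G y u w) := by
  have h1 := hG.apply_christoffel hy u v w
  have h2 := hG.apply_christoffel hy u w v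
  rw [hG.symm y hy _ v] at h2
  simp only [koszul, add_apply, sub_apply,
      ContinuousLinearMap.flip_apply] at h1 h2
  have := hG.fderiv_symm hy u w v
  have := hG.fderiv_symm hy v w u
  have := hG.fderiv_symm hy w u v
  linarith

theorem contDiffAt_inverse [CompleteSpace E] (hG : IsMetricOn G U) (hy : y ∈ U) :
    ContDiffAt ℝ ∞ (fun z => (G z).inverse) y :=
  (hG.isInvertible y hy).contDiffAt_map_inverse.comp y (hG.contDiffAt hy)

theorem contDiffAt_koszul (hG : IsMetricOn G U) (hy : y ∈ U) (u v : E) :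
    ContDiffAt ℝ ∞ (fun z => koszul G z u v) y := by
  have hd := contDiffAt_fderiv (hG.contDiffAt hy)
  have c1 (a b : E) : ContDiffAt ℝ ∞ (fun z => fderiv ℝ G z a b) y :=
    (hd.clm_apply contDiffAt_const).clm_apply contDiffAt_const
  have h3 : ContDiffAt ℝ ∞ (fun z => (fderiv ℝ G z).flip u) y :=
    (contDiffAt_flip hd).clm_apply contDiffAt_const
  have h4 : ContDiffAt ℝ ∞ (fun z => ((fderiv ℝ G z).flip u).flip v) y :=
    (contDiffAt_flip h3).clm_apply contDiffAt_const
  exact ((c1 u v).add (c1 v u)).sub h4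

theorem contDiffAt_christoffel [CompleteSpace E] (hG : IsMetricOn G U) (hy : y ∈ U) (u v : E) :
    ContDiffAt ℝ ∞ (fun z => christoffel G z u v) y :=
  contDiffAt_const.smul ((hG.contDiffAt_inverse hy).clm_apply (hG.contDiffAt_koszul hy u v))

theorem differentiableAt_christoffel [CompleteSpace E] (hG : IsMetricOn G U) (hy : y ∈ U)
    (u v : E) : DifferentiableAt ℝ (fun z => christoffel G z u v) y :=
  (hG.contDiffAt_christoffel hy u v).differentiableAt (by simp)

/-- The curvature in terms of the Christoffel symbols. -/
theorem curvature_const (hG : IsMetricOn G U) (hy : y ∈ U) (u v w : E) :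
    curvature G (fun _ => u) (fun _ => v) (fun _ => w) y =
      fderiv ℝ (fun z => christoffel G z u w) y v + christoffel G y v (christoffel G y u w)
      - (fderiv ℝ (fun z => christoffel G z v w) y u
        + christoffel G y u (christoffel G y v w)) := by
  have hn (a b : E) : nabla G (fun _ => a) (fun _ => b) = fun z => christoffel G z a b := by
    ext z; simp [nabla]
  have h0 : christoffel G y 0 w = 0 := by
    rw [hG.christoffel_symm hy]
    simpa using hG.christoffel_smul_right hy w 0 0
  unfold curvature
  rw [hn, hn]
  simp [nabla, VectorField.lieBracket, h0]

theorem apply_gradient (hG : IsMetricOn G U) (hy : y ∈ U) (h : E → ℝ) (v : E) :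
    G y (gradient G h y) v = fderiv ℝ h y v := by
  unfold gradient
  rw [(hG.isInvertible y hy).self_apply_inverse]

theorem eq_of_apply_eq (hG : IsMetricOn G U) (hy : y ∈ U) {u v : E}
    (h : ∀ w, G y u w = G y v w) : u = v :=
  (hG.isInvertible y hy).injective (ContinuousLinearMap.ext h)

theorem differentiableAt_gradient [CompleteSpace E] (hG : IsMetricOn G U) (hy : y ∈ U) {h : E → ℝ}
    (hh : ContDiffAt ℝ ∞ h y) : DifferentiableAt ℝ (gradient G h) y :=
  ((hG.contDiffAt_inverse hy).clm_apply (contDiffAt_fderiv hh)).differentiableAt (by simp)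

/-- The Hessian in terms of the Christoffel symbols. -/
theorem apply_nabla_gradient [CompleteSpace E] (hG : IsMetricOn G U) (hy : y ∈ U) {h : E → ℝ}
    (hh : ContDiffAt ℝ ∞ h y) (u v : E) :
    G y (nabla G (fun _ => u) (gradient G h) y) v =
      fderiv ℝ (fderiv ℝ h) y u v - fderiv ℝ h y (christoffel G y u v) := by
  -- The identity G(grad h, v) = dh(v) is differentiated along `u`; metric compatibility then turns
  -- the derivative of G into Christoffel terms, one of which is dh(Γ(u, v)).
  have e : (fun z => G z (gradient G h z) v) =ᶠ[𝓝 y] fun z => fderiv ℝ h z v := by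
    filter_upwards [hG.isOpen.mem_nhds hy] with z hz using hG.apply_gradient hz h v
  have h1 := ((hG.differentiableAt hy).hasFDerivAt.clm_apply
    (hG.differentiableAt_gradient hy hh).hasFDerivAt).clm_apply (hasFDerivAt_const v y)
  have h2 := ((contDiffAt_fderiv hh).differentiableAt (by simp)).hasFDerivAt.clm_apply
    (hasFDerivAt_const v y)
  have h3 := DFunLike.congr_fun ((h1.congr_of_eventuallyEq e.symm).unique h2) u
  have h4 := hG.fderiv_eq_christoffel hy u (gradient G h y) v
  rw [hG.apply_gradient hy] at h4
  simp at h3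
  simp only [nabla, map_add, add_apply]
  linarith

theorem fderiv_gradient_normSq [CompleteSpace E] (hG : IsMetricOn G U) (hy : y ∈ U) {h : E → ℝ}
    (hh : ContDiffAt ℝ ∞ h y) (u : E) :
    fderiv ℝ (fun z => G z (gradient G h z) (gradient G h z)) y u =
      2 * G y (nabla G (fun _ => u) (gradient G h) y) (gradient G h y) := by
  have hg := (hG.differentiableAt_gradient hy hh).hasFDerivAt
  have h1 := ((hG.differentiableAt hy).hasFDerivAt.clm_apply hg).clm_apply hg
  have h4 := hG.fderiv_eq_christoffel hy u (gradient G h y) (gradient G h y)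
  rw [hG.symm y hy (gradient G h y) (christoffel G y u _)] at h4
  have h5 := hG.symm y hy (gradient G h y) (fderiv ℝ (gradient G h) y u)
  rw [h1.fderiv]
  simp [nabla]
  linarith

theorem differentiableAt_gradient_normSq [CompleteSpace E] (hG : IsMetricOn G U) (hy : y ∈ U)
    {h : E → ℝ} (hh : ContDiffAt ℝ ∞ h y) :
    DifferentiableAt ℝ (fun z => G z (gradient G h z) (gradient G h z)) y :=
  ((hG.differentiableAt hy).clm_apply (hG.differentiableAt_gradient hy hh)).clm_apply
    (hG.differentiableAt_gradient hy hh)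

end IsMetricOn
end Coord

/-! ### Connection and curvature of a warped product in coordinates -/

namespace Coord

variable {E₁ : Type*} [NormedAddCommGroup E₁] [NormedSpace ℝ E₁]
  {E₂ : Type*} [NormedAddCommGroup E₂] [NormedSpace ℝ E₂]

/-- The coordinate expression `G` of the warped product metric `G₁ ⊕ φ² G₂` on `U ⊆ U₁ × U₂`. -/
structure IsWarpedOn (G : E₁ × E₂ → ((E₁ × E₂) →L[ℝ] (E₁ × E₂) →L[ℝ] ℝ)) (U : Set (E₁ × E₂))
    (G₁ : E₁ → (E₁ →L[ℝ] E₁ →L[ℝ] ℝ)) (U₁ : Set E₁) (φ : E₁ → ℝ)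
    (G₂ : E₂ → (E₂ →L[ℝ] E₂ →L[ℝ] ℝ)) (U₂ : Set E₂) : Prop where
  metric : IsMetricOn G U
  base : IsMetricOn G₁ U₁
  fiber : IsMetricOn G₂ U₂
  contDiffOn : ContDiffOn ℝ ∞ φ U₁
  ne_zero : ∀ y ∈ U₁, φ y ≠ 0
  subset : U ⊆ U₁ ×ˢ U₂
  eq_orthSum : ∀ y ∈ U, G y = orthSum (G₁ y.1) (φ y.1 ^ 2) (G₂ y.2)

namespace IsWarpedOn

variable {G : E₁ × E₂ → ((E₁ × E₂) →L[ℝ] (E₁ × E₂) →L[ℝ] ℝ)} {U : Set (E₁ × E₂)}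
  {G₁ : E₁ → (E₁ →L[ℝ] E₁ →L[ℝ] ℝ)} {U₁ : Set E₁} {φ : E₁ → ℝ}
  {G₂ : E₂ → (E₂ →L[ℝ] E₂ →L[ℝ] ℝ)} {U₂ : Set E₂} {y : E₁ × E₂}

theorem contDiffAt (h : IsWarpedOn G U G₁ U₁ φ G₂ U₂) {z : E₁} (hz : z ∈ U₁) :
    ContDiffAt ℝ ∞ φ z :=
  h.contDiffOn.contDiffAt (h.base.isOpen.mem_nhds hz)

theorem apply_eq (h : IsWarpedOn G U G₁ U₁ φ G₂ U₂) (hy : y ∈ U) (v w : E₁ × E₂) :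
    G y v w = G₁ y.1 v.1 w.1 + φ y.1 ^ 2 * G₂ y.2 v.2 w.2 := by
  rw [h.eq_orthSum y hy]; rfl

theorem fderiv_apply (h : IsWarpedOn G U G₁ U₁ φ G₂ U₂) (hy : y ∈ U) (u v w : E₁ × E₂) :
    fderiv ℝ G y u v w = fderiv ℝ G₁ y.1 u.1 v.1 w.1
      + 2 * φ y.1 * fderiv ℝ φ y.1 u.1 * G₂ y.2 v.2 w.2
      + φ y.1 ^ 2 * fderiv ℝ G₂ y.2 u.2 v.2 w.2 := by
  have hy1 := (h.subset hy).1
  have hy2 := (h.subset hy).2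
  have e : (fun z => G z v w) =ᶠ[𝓝 y]
      fun z => G₁ z.1 v.1 w.1 + φ z.1 ^ 2 * G₂ z.2 v.2 w.2 := by
    filter_upwards [h.metric.isOpen.mem_nhds hy] with z hz using h.apply_eq hz v w
  have d1 := (h.base.hasFDerivAt_apply₂ hy1 v.1 w.1).comp y
    (hasFDerivAt_fst (𝕜 := ℝ) (E := E₁) (F := E₂))
  have d2 := (h.fiber.hasFDerivAt_apply₂ hy2 v.2 w.2).comp y
    (hasFDerivAt_snd (𝕜 := ℝ) (E := E₁) (F := E₂))
  have d3 := ((((h.contDiffAt hy1).differentiableAt (by simp)).hasFDerivAt).comp y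
    (hasFDerivAt_fst (𝕜 := ℝ) (E := E₁) (F := E₂))).pow 2
  have d := (d1.add (d3.mul d2)).congr_of_eventuallyEq e
  rw [← h.metric.fderiv_apply₂ hy, d.fderiv]
  simp
  ring

/-- The terms beyond the product connection come from differentiating the factor φ² in the Koszul
identity. The derivative along `w.1` yields the gradient term; those along `u.1` and `v.1` yield 2φ
dφ, and dividing by 2φ² leaves dφ/φ. -/
theorem christoffel_eq (h : IsWarpedOn G U G₁ U₁ φ G₂ U₂) (hy : y ∈ U) (u v : E₁ × E₂) :
    christoffel G y u v =
      (christoffel G₁ y.1 u.1 v.1 - (φ y.1 * G₂ y.2 u.2 v.2) • gradient G₁ φ y.1,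
        christoffel G₂ y.2 u.2 v.2 + (fderiv ℝ φ y.1 u.1 / φ y.1) • v.2
          + (fderiv ℝ φ y.1 v.1 / φ y.1) • u.2) := by
  have hy1 := (h.subset hy).1
  have hy2 := (h.subset hy).2
  refine h.metric.christoffel_eq hy fun w => ?_
  have hφ := h.ne_zero _ hy1
  have k1 := h.base.apply_christoffel hy1 u.1 v.1 w.1
  have k2 := h.fiber.apply_christoffel hy2 u.2 v.2 w.2
  have k3 := h.fiber.symm _ hy2 u.2 v.2
  simp only [koszul, add_apply, sub_apply, ContinuousLinearMap.flip_apply] at k1 k2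
  rw [h.apply_eq hy]
  simp only [koszul, add_apply, sub_apply, ContinuousLinearMap.flip_apply, h.fderiv_apply hy,
    map_add, map_sub, map_smul, smul_apply, smul_eq_mul, h.base.apply_gradient hy1]
  have e1 : fderiv ℝ φ y.1 u.1 / φ y.1 * φ y.1 = fderiv ℝ φ y.1 u.1 := div_mul_cancel₀ _ hφ
  have e2 : fderiv ℝ φ y.1 v.1 / φ y.1 * φ y.1 = fderiv ℝ φ y.1 v.1 := div_mul_cancel₀ _ hφ
  linear_combination k1 + φ y.1 ^ 2 * k2 + 2 * φ y.1 * G₂ y.2 v.2 w.2 * e1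
    + 2 * φ y.1 * G₂ y.2 u.2 w.2 * e2

variable [CompleteSpace E₁] [CompleteSpace E₂]

theorem fderiv_christoffel (h : IsWarpedOn G U G₁ U₁ φ G₂ U₂) (hy : y ∈ U) (u w v : E₁ × E₂) :
    fderiv ℝ (fun z => christoffel G z u w) y v =
      (fderiv ℝ (fun z => christoffel G₁ z u.1 w.1) y.1 v.1
          - (φ y.1 * G₂ y.2 u.2 w.2) • fderiv ℝ (gradient G₁ φ) y.1 v.1
          - (fderiv ℝ φ y.1 v.1 * G₂ y.2 u.2 w.2
            + φ y.1 * fderiv ℝ G₂ y.2 v.2 u.2 w.2) • gradient G₁ φ y.1,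
        fderiv ℝ (fun z => christoffel G₂ z u.2 w.2) y.2 v.2
          + (fderiv ℝ (fderiv ℝ φ) y.1 v.1 u.1 / φ y.1
            - fderiv ℝ φ y.1 u.1 * fderiv ℝ φ y.1 v.1 / φ y.1 ^ 2) • w.2
          + (fderiv ℝ (fderiv ℝ φ) y.1 v.1 w.1 / φ y.1
            - fderiv ℝ φ y.1 w.1 * fderiv ℝ φ y.1 v.1 / φ y.1 ^ 2) • u.2) := by
  have hy1 := (h.subset hy).1
  have hy2 := (h.subset hy).2
  have hφ := h.ne_zero _ hy1
  have e := Filter.eventuallyEq_of_mem (h.metric.isOpen.mem_nhds hy)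
    fun z hz => h.christoffel_eq hz u w
  have p1 := hasFDerivAt_fst (𝕜 := ℝ) (E := E₁) (F := E₂) (p := y)
  have p2 := hasFDerivAt_snd (𝕜 := ℝ) (E := E₁) (F := E₂) (p := y)
  have dφ := ((h.contDiffAt hy1).differentiableAt (by simp)).hasFDerivAt.comp y p1
  have ddφ (a : E₁) : HasFDerivAt (fun z => fderiv ℝ φ z a) ((fderiv ℝ (fderiv ℝ φ) y.1).flip a)
      y.1 := by
    have := ((contDiffAt_fderiv (h.contDiffAt hy1)).differentiableAt (by simp)).hasFDerivAt
    simpa using this.clm_apply (hasFDerivAt_const a y.1)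
  have dg := (h.base.differentiableAt_gradient hy1 (h.contDiffAt hy1)).hasFDerivAt.comp y p1
  have d1 := (h.base.differentiableAt_christoffel hy1 u.1 w.1).hasFDerivAt.comp y p1
  have d2 := (h.fiber.differentiableAt_christoffel hy2 u.2 w.2).hasFDerivAt.comp y p2
  have d3 := (h.fiber.hasFDerivAt_apply₂ hy2 u.2 w.2).comp y p2
  have di := (hasDerivAt_inv hφ).comp_hasFDerivAt y dφ
  have q (a : E₁) := ((ddφ a).comp y p1).mul di
  have d := ((d1.sub ((dφ.mul d3).smul dg)).prodMk
    ((d2.add ((q u.1).smul_const w.2)).add ((q w.1).smul_const u.2))).congr_of_eventuallyEq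
    (by simp only [div_eq_mul_inv] at e; exact e)
  rw [d.fderiv]
  refine Prod.ext ?_ ?_
  · simp
    module
  · simp
    match_scalars <;> field_simp
    all_goals ring

/-- The curvature of a warped product. -/
theorem curvature_eq (h : IsWarpedOn G U G₁ U₁ φ G₂ U₂) (hy : y ∈ U) (u v w : E₁ × E₂) :
    curvature G (fun _ => u) (fun _ => v) (fun _ => w) y =
      (curvature G₁ (fun _ => u.1) (fun _ => v.1) (fun _ => w.1) y.1
          - (φ y.1 * G₂ y.2 u.2 w.2) • nabla G₁ (fun _ => v.1) (gradient G₁ φ) y.1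
          + (φ y.1 * G₂ y.2 v.2 w.2) • nabla G₁ (fun _ => u.1) (gradient G₁ φ) y.1,
        curvature G₂ (fun _ => u.2) (fun _ => v.2) (fun _ => w.2) y.2
          - G₁ y.1 (gradient G₁ φ y.1) (gradient G₁ φ y.1) •
            (G₂ y.2 u.2 w.2 • v.2 - G₂ y.2 v.2 w.2 • u.2)
          - (1 / φ y.1) • (G₁ y.1 (nabla G₁ (fun _ => u.1) (gradient G₁ φ) y.1) w.1 • v.2
            - G₁ y.1 (nabla G₁ (fun _ => v.1) (gradient G₁ φ) y.1) w.1 • u.2)) := by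
  have hy1 := (h.subset hy).1
  have hy2 := (h.subset hy).2
  have hφ := h.ne_zero _ hy1
  have s2 (b c : E₂) : G₂ y.2 b c = G₂ y.2 c b := h.fiber.symm _ hy2 _ _
  have sub1 (a b c : E₁) (r : ℝ) : christoffel G₁ y.1 a (b - r • c) =
      christoffel G₁ y.1 a b - r • christoffel G₁ y.1 a c := by
    rw [sub_eq_add_neg, ← neg_smul, h.base.christoffel_add_right hy1,
      h.base.christoffel_smul_right hy1]
    module
  rw [h.metric.curvature_const hy, h.base.curvature_const hy1, h.fiber.curvature_const hy2,
    h.fderiv_christoffel hy, h.fderiv_christoffel hy, h.christoffel_eq hy, h.christoffel_eq hy,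
    h.christoffel_eq hy, h.christoffel_eq hy,
    h.base.apply_nabla_gradient hy1 (h.contDiffAt hy1),
    h.base.apply_nabla_gradient hy1 (h.contDiffAt hy1), h.base.apply_gradient hy1]
  -- By compatibility the derivatives of G₂ in the horizontal component become Christoffel terms.
  -- With those from the quadratic part they form an expression symmetric in `u` and `v`, which the
  -- antisymmetrization kills.
  have f1 := h.fiber.fderiv_eq_christoffel hy2 v.2 u.2 w.2
  have f2 := h.fiber.fderiv_eq_christoffel hy2 u.2 v.2 w.2
  -- Symmetry of the second derivative of φ removes the terms along `w.2`.
  have hs : fderiv ℝ (fderiv ℝ φ) y.1 u.1 v.1 = fderiv ℝ (fderiv ℝ φ) y.1 v.1 u.1 :=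
    ((h.contDiffAt hy1).isSymmSndFDerivAt (by
      rw [minSmoothness_of_isRCLikeNormedField]
      exact WithTop.coe_le_coe.2 (le_top : (2 : ℕ∞) ≤ ⊤))) u.1 v.1
  refine Prod.ext ?_ ?_
  · simp only [Prod.fst_add, Prod.fst_sub, nabla, sub1, f1, f2, map_add, map_smul, smul_eq_mul]
    rw [h.fiber.christoffel_symm hy2 v.2 u.2, s2 v.2 u.2,
      s2 (christoffel G₂ y.2 u.2 v.2) w.2, s2 v.2 (christoffel G₂ y.2 u.2 w.2),
      s2 u.2 (christoffel G₂ y.2 v.2 w.2)]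
    match_scalars <;> field_simp
    all_goals ring
  · simp only [Prod.snd_add, Prod.snd_sub, map_sub, map_add, map_smul, smul_eq_mul,
      h.fiber.christoffel_add_right hy2, h.fiber.christoffel_smul_right hy2, hs]
    rw [h.fiber.christoffel_symm hy2 v.2 u.2]
    match_scalars <;> field_simp
    all_goals ring

end IsWarpedOn
end Coord

/-! ### From charts to the manifold -/

namespace PseudoRiemannianMetric

variable {E : Type*} [NormedAddCommGroup E] [NormedSpace ℝ E]
  {M : Type*} [TopologicalSpace M] [ChartedSpace E M]

/-- The derivative at `y` of the inverse of the chart around `x`, as an endomorphism of `E`. -/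
def symmDeriv (x : M) (y : E) : E →L[ℝ] E :=
  mfderiv 𝓘(ℝ, E) 𝓘(ℝ, E) (extChartAt 𝓘(ℝ, E) x).symm y

/-- The differential of a function at a point, as a linear form on `E`. -/
def differential (f : M → ℝ) (x : M) : E →L[ℝ] ℝ :=
  mfderiv 𝓘(ℝ, E) 𝓘(ℝ, ℝ) f x

/-- A pseudo-Riemannian metric at a point, as a bilinear form on `E`. -/
def form (g : PseudoRiemannianMetric 𝓘(ℝ, E) M) (x : M) : E →L[ℝ] E →L[ℝ] ℝ :=
  g.toFun x

theorem form_nondegenerate (g : PseudoRiemannianMetric 𝓘(ℝ, E) M) (x : M) {u : E}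
    (h : ∀ v, g.form x u v = 0) : u = 0 :=
  g.nondegenerate x u h

/-- The tangent space at `x` is identified with `E` through the chart around `x` itself. Hence the
coordinate metric at the base point is the metric there, and pointwise tensors can be read off
without a change of frame. -/
theorem symmDeriv_self [IsManifold 𝓘(ℝ, E) ∞ M] (x : M) :
    symmDeriv x (extChartAt 𝓘(ℝ, E) x x) = ContinuousLinearMap.id ℝ E := by
  have : IsManifold 𝓘(ℝ, E) 1 M := IsManifold.of_le (n := ∞) (by simp)
  have h := mfderivWithin_range_extChartAt_symm (I := 𝓘(ℝ, E)) (x := x)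
  rw [ModelWithCorners.range_eq_univ, mfderivWithin_univ] at h
  exact h

theorem isInvertible_symmDeriv [IsManifold 𝓘(ℝ, E) ∞ M] (x : M) {y : E}
    (hy : y ∈ (extChartAt 𝓘(ℝ, E) x).target) : (symmDeriv x y).IsInvertible := by
  have : IsManifold 𝓘(ℝ, E) 1 M := IsManifold.of_le (n := ∞) (by simp)
  have h := isInvertible_mfderivWithin_extChartAt_symm (I := 𝓘(ℝ, E)) hy
  rw [ModelWithCorners.range_eq_univ, mfderivWithin_univ] at h
  exact h

theorem mdifferentiableAt_extChartAt_symm [IsManifold 𝓘(ℝ, E) ∞ M] (x : M) {y : E}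
    (hy : y ∈ (extChartAt 𝓘(ℝ, E) x).target) :
    MDifferentiableAt 𝓘(ℝ, E) 𝓘(ℝ, E) (extChartAt 𝓘(ℝ, E) x).symm y :=
  ((contMDiffOn_extChartAt_symm (I := 𝓘(ℝ, E)) (n := ∞) x).contMDiffAt
    ((isOpen_extChartAt_target x).mem_nhds hy)).mdifferentiableAt (by simp)

theorem contDiffOn_comp_extChartAt_symm [IsManifold 𝓘(ℝ, E) ∞ M] {f : M → ℝ}
    (hf : ContMDiff 𝓘(ℝ, E) 𝓘(ℝ, ℝ) ∞ f) (x : M) :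
    ContDiffOn ℝ ∞ (f ∘ (extChartAt 𝓘(ℝ, E) x).symm) (extChartAt 𝓘(ℝ, E) x).target :=
  (hf.comp_contMDiffOn (contMDiffOn_extChartAt_symm x)).contDiffOn

section

variable (g : PseudoRiemannianMetric 𝓘(ℝ, E) M)

theorem coeff_apply (x : M) (y u v : E) :
    g.coeff x y u v =
      g.form ((extChartAt 𝓘(ℝ, E) x).symm y) (symmDeriv x y u) (symmDeriv x y v) := rfl

variable [IsManifold 𝓘(ℝ, E) ∞ M]

theorem coeff_self (x : M) : g.coeff x (extChartAt 𝓘(ℝ, E) x x) = g.form x := by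
  ext u v
  rw [coeff_apply, symmDeriv_self, extChartAt_to_inv]
  rfl

theorem isMetricOn_coeff [FiniteDimensional ℝ E] (x : M) :
    Coord.IsMetricOn (g.coeff x) (extChartAt 𝓘(ℝ, E) x).target where
  isOpen := isOpen_extChartAt_target x
  contDiffOn := g.smooth x
  symm y _ u v := g.symm ((extChartAt 𝓘(ℝ, E) x).symm y) (symmDeriv x y u) (symmDeriv x y v)
  isInvertible y hy := by
    refine Coord.isInvertible_of_nondegenerate _ fun u hu => ?_
    have hA := isInvertible_symmDeriv x hy
    refine hA.injective ?_
    rw [map_zero]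
    refine g.form_nondegenerate ((extChartAt 𝓘(ℝ, E) x).symm y) fun v => ?_
    obtain ⟨w, rfl⟩ := hA.surjective v
    exact hu w

variable [FiniteDimensional ℝ E]

/-- The gradient read in the chart around `x` is the intrinsic gradient. -/
theorem form_symmDeriv_gradient {f : M → ℝ} (hf : ContMDiff 𝓘(ℝ, E) 𝓘(ℝ, ℝ) ∞ f) (x : M) {y : E}
    (hy : y ∈ (extChartAt 𝓘(ℝ, E) x).target) (v : E) :
    g.form ((extChartAt 𝓘(ℝ, E) x).symm y)
      (symmDeriv x y (Coord.gradient (g.coeff x) (f ∘ (extChartAt 𝓘(ℝ, E) x).symm) y)) v =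
      differential f ((extChartAt 𝓘(ℝ, E) x).symm y) v := by
  obtain ⟨w, rfl⟩ := (isInvertible_symmDeriv x hy).surjective v
  have h1 := (g.isMetricOn_coeff x).apply_gradient hy (f ∘ (extChartAt 𝓘(ℝ, E) x).symm) w
  have h2 := mfderiv_comp y (hf.mdifferentiableAt (by simp)) (mdifferentiableAt_extChartAt_symm x hy)
  rw [mfderiv_eq_fderiv] at h2
  exact h1.trans (DFunLike.congr_fun h2 w)

theorem form_grad {f : M → ℝ} (hf : ContMDiff 𝓘(ℝ, E) 𝓘(ℝ, ℝ) ∞ f) (x : M) (v : E) :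
    g.form x (g.grad f x) v = differential f x v := by
  have h := g.form_symmDeriv_gradient hf x (mem_extChartAt_target x) v
  rw [symmDeriv_self, extChartAt_to_inv] at h
  exact h

/-- The squared length of the gradient can be computed in any chart. -/
theorem gradNormSq_extChartAt_symm {f : M → ℝ} (hf : ContMDiff 𝓘(ℝ, E) 𝓘(ℝ, ℝ) ∞ f) (x : M) {y : E}
    (hy : y ∈ (extChartAt 𝓘(ℝ, E) x).target) :
    g.gradNormSq f ((extChartAt 𝓘(ℝ, E) x).symm y) = g.coeff x y
      (Coord.gradient (g.coeff x) (f ∘ (extChartAt 𝓘(ℝ, E) x).symm) y)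
      (Coord.gradient (g.coeff x) (f ∘ (extChartAt 𝓘(ℝ, E) x).symm) y) := by
  -- The left side is defined by the chart around the moving point, the right side by the fixed
  -- chart around `x`; both represent df, so nondegeneracy identifies them.
  have h : (show E from g.grad f ((extChartAt 𝓘(ℝ, E) x).symm y)) = symmDeriv x y
      (Coord.gradient (g.coeff x) (f ∘ (extChartAt 𝓘(ℝ, E) x).symm) y) := by
    refine sub_eq_zero.1 (g.form_nondegenerate ((extChartAt 𝓘(ℝ, E) x).symm y) fun v => ?_)
    have h1 := g.form_grad hf ((extChartAt 𝓘(ℝ, E) x).symm y) v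
    have h2 := g.form_symmDeriv_gradient hf x hy v
    rw [(g.form _).map_sub, sub_apply, h2, sub_eq_zero]
    exact h1
  rw [coeff_apply, ← h]
  rfl

end

/-- A function on a connected manifold is constant if at every point its derivative, computed in the
chart around that point, vanishes. -/
theorem apply_eq_of_hasFDerivAt_zero [IsManifold 𝓘(ℝ, E) ∞ M] [PreconnectedSpace M] {k : M → ℝ}
    (hk : ∀ x, HasFDerivAt (k ∘ (extChartAt 𝓘(ℝ, E) x).symm) (0 : E →L[ℝ] ℝ)
      (extChartAt 𝓘(ℝ, E) x x)) (x x' : M) : k x = k x' := by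
  -- The hypothesis controls each point only in its own chart. Passing to the manifold derivative
  -- removes this dependence, so that `hd` below holds throughout the target of one fixed chart.
  have hm (x : M) : HasMFDerivAt 𝓘(ℝ, E) 𝓘(ℝ, ℝ) k x 0 := by
    have h1 : HasMFDerivAt 𝓘(ℝ, E) 𝓘(ℝ, E) (extChartAt 𝓘(ℝ, E) x) x _ :=
      ((contMDiffAt_extChartAt (n := ∞)).mdifferentiableAt (by simp)).hasMFDerivAt
    have h2 : HasMFDerivAt 𝓘(ℝ, E) 𝓘(ℝ, ℝ)
        ((k ∘ (extChartAt 𝓘(ℝ, E) x).symm) ∘ extChartAt 𝓘(ℝ, E) x) x 0 := by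
      convert! (hk x).hasMFDerivAt.comp x h1 using 1
    refine h2.congr_of_eventuallyEq ?_
    filter_upwards [extChartAt_source_mem_nhds (I := 𝓘(ℝ, E)) x] with z hz
    rw [Function.comp_apply, Function.comp_apply, (extChartAt 𝓘(ℝ, E) x).left_inv hz]
  have hl : IsLocallyConstant k := by
    refine (IsLocallyConstant.iff_eventually_eq k).2 fun x => ?_
    have hd {y : E} (hy : y ∈ (extChartAt 𝓘(ℝ, E) x).target) :
        HasFDerivAt (k ∘ (extChartAt 𝓘(ℝ, E) x).symm) (0 : E →L[ℝ] ℝ) y := by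
      have h := (hm _).comp y (mdifferentiableAt_extChartAt_symm x hy).hasMFDerivAt
      exact h.hasFDerivAt
    -- A ball inside the chart target is convex, so a vanishing derivative forces constancy on it.
    obtain ⟨r, hr, hB⟩ := Metric.isOpen_iff.1 (isOpen_extChartAt_target (I := 𝓘(ℝ, E)) x) _
      (mem_extChartAt_target x)
    have hpre := (continuousAt_extChartAt (I := 𝓘(ℝ, E)) x).preimage_mem_nhds
      (Metric.ball_mem_nhds _ hr)
    filter_upwards [hpre, extChartAt_source_mem_nhds (I := 𝓘(ℝ, E)) x] with z hz hzs
    have hc := (convex_ball (extChartAt 𝓘(ℝ, E) x x) r).is_const_of_fderivWithin_eq_zero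
      (𝕜 := ℝ) (f := k ∘ (extChartAt 𝓘(ℝ, E) x).symm)
      (fun w hw => (hd (hB hw)).differentiableAt.differentiableWithinAt)
      (fun w hw => by
        rw [fderivWithin_of_isOpen Metric.isOpen_ball hw]; exact (hd (hB hw)).fderiv)
      hz (Metric.mem_ball_self hr)
    rw [Function.comp_apply, Function.comp_apply, (extChartAt 𝓘(ℝ, E) x).left_inv hzs,
      extChartAt_to_inv] at hc
    exact hc
  exact hl.apply_eq_of_preconnectedSpace x x'

end PseudoRiemannianMetric

/-- Linearity of `koszul` in its last vector suffices, with no condition on G. This removes the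
fiber curvature when the mixed component is evaluated on horizontal and vertical vectors. -/
theorem Coord.curvature_const_zero {E : Type*} [NormedAddCommGroup E] [NormedSpace ℝ E]
    (G : E → (E →L[ℝ] E →L[ℝ] ℝ)) (u v y : E) :
    curvature G (fun _ => u) (fun _ => v) (fun _ => 0) y = 0 := by
  have h0 (z a : E) : christoffel G z a 0 = 0 := by
    simp [christoffel, koszul]
  have hn (X : E → E) : nabla G X (fun _ => 0) = fun _ => 0 := by
    ext z; simp [nabla, h0]
  simp [curvature, hn]

/-- `B(u, w) v - B(v, w) u` does not vanish identically in dimension at least two. -/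
theorem eq_of_smul_curvatureForm_eq {E : Type*} [NormedAddCommGroup E] [NormedSpace ℝ E]
    (B : E →L[ℝ] E →L[ℝ] ℝ) (hB : ∀ u, (∀ v, B u v = 0) → u = 0) (hE : 2 ≤ finrank ℝ E) {a b : ℝ}
    (h : ∀ u v w, a • (B u w • v - B v w • u) = b • (B u w • v - B v w • u)) : a = b := by
  have : Nontrivial E := Module.nontrivial_of_finrank_pos (R := ℝ) (by omega)
  obtain ⟨u, hu⟩ := exists_ne (0 : E)
  -- For independent `u`, `v`, vanishing of B(u, w) v - B(v, w) u would force B(u, w) = 0, which the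
  -- choice of `w` excludes.
  obtain ⟨v, huv⟩ := exists_linearIndependent_pair_of_one_lt_finrank (R := ℝ) (by omega) hu
  obtain ⟨w, hw⟩ : ∃ w, B u w ≠ 0 := by
    by_contra! hc
    exact hu (hB u hc)
  by_contra hab
  have h1 := h u v w
  rw [← sub_eq_zero, ← sub_smul] at h1
  have h2 := (smul_eq_zero.1 h1).resolve_left (sub_ne_zero.2 hab)
  have h3 := (LinearIndependent.pair_iff.1 huv (-B v w) (B u w) (by rw [← h2]; module)).2
  exact hw h3

/-! ### Hessian proportional to the metric -/

namespace PseudoRiemannianMetric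

section

variable {E : Type*} [NormedAddCommGroup E] [NormedSpace ℝ E]
  {M : Type*} [TopologicalSpace M] [ChartedSpace E M]
  (g : PseudoRiemannianMetric 𝓘(ℝ, E) M)

/-- The curvature operator at a point, on `E`. -/
def curv (x : M) (u v w : E) : E :=
  Coord.curvature (g.coeff x) (fun _ => u) (fun _ => v) (fun _ => w) (extChartAt 𝓘(ℝ, E) x x)

/-- The Hessian operator `u ↦ ∇_u grad f` at a point, on `E`. -/
def hessianOp (f : M → ℝ) (x : M) (u : E) : E :=
  Coord.nabla (g.coeff x) (fun _ => u)
    (Coord.gradient (g.coeff x) (f ∘ (extChartAt 𝓘(ℝ, E) x).symm)) (extChartAt 𝓘(ℝ, E) x x)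

/-- Nondegeneracy upgrades the bilinear condition to an operator identity, the form needed both in
the curvature formula and in the derivative of ‖grad f‖². -/
theorem hessianOp_eq_of_hessian {f : M → ℝ} {x : M} {k : ℝ} (hx : f x ≠ 0)
    (h : ∀ u v : E, 1 / f x * g.form x (g.hessianOp f x u) v + k * g.form x u v = 0) (u : E) :
    g.hessianOp f x u = (-(k * f x)) • u := by
  refine sub_eq_zero.1 (g.form_nondegenerate x fun v => ?_)
  have h1 := h u v
  field_simp at h1
  rw [map_sub, map_smul, sub_apply, smul_apply, smul_eq_mul]
  linarith

/-- A function `k` with `H^f + k f g = 0` for which `k f² + ‖grad f‖²` is constant is constant. -/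
theorem apply_eq_of_hessian_eq [FiniteDimensional ℝ E] [IsManifold 𝓘(ℝ, E) ∞ M]
    [PreconnectedSpace M] {f k : M → ℝ} {c : ℝ} (hf : ContMDiff 𝓘(ℝ, E) 𝓘(ℝ, ℝ) ∞ f)
    (hpos : ∀ p, 0 < f p)
    (hH : ∀ p (u v : E), 1 / f p * g.form p (g.hessianOp f p u) v + k p * g.form p u v = 0)
    (hc : ∀ p, k p * f p ^ 2 + g.gradNormSq f p = c) (p p' : M) : k p = k p' := by
  have : CompleteSpace E := FiniteDimensional.complete ℝ E
  refine apply_eq_of_hasFDerivAt_zero (E := E) (fun x => ?_) p p'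
  have hx := mem_extChartAt_target (I := 𝓘(ℝ, E)) x
  have hG := g.isMetricOn_coeff x
  set φ := f ∘ (extChartAt 𝓘(ℝ, E) x).symm with hφ
  set y := extChartAt 𝓘(ℝ, E) x x with hy
  have hs : ContDiffAt ℝ ∞ φ y :=
    (contDiffOn_comp_extChartAt_symm hf x).contDiffAt (hG.isOpen.mem_nhds hx)
  have hφy : φ y = f x := by rw [hφ, Function.comp_apply, hy, extChartAt_to_inv]
  have hne : φ y ^ 2 ≠ 0 := by rw [hφy]; exact pow_ne_zero 2 (hpos x).ne'
  have d1 := (hG.differentiableAt_gradient_normSq hx hs).hasFDerivAt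
  have d2 := ((hs.differentiableAt (by simp)).hasFDerivAt.pow 2)
  have d3 := (d1.const_sub c).mul ((hasDerivAt_inv hne).comp_hasFDerivAt y d2)
  -- No regularity of `k` is assumed: solving `hc` for `k` expresses it through f and ‖grad f‖²,
  -- which makes it differentiable.
  have e : k ∘ (extChartAt 𝓘(ℝ, E) x).symm =ᶠ[𝓝 y] fun z =>
      (c - g.coeff x z (Coord.gradient (g.coeff x) φ z) (Coord.gradient (g.coeff x) φ z)) *
        (φ z ^ 2)⁻¹ := by
    filter_upwards [hG.isOpen.mem_nhds hx] with z hz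
    have h1 := hc ((extChartAt 𝓘(ℝ, E) x).symm z)
    rw [g.gradNormSq_extChartAt_symm hf x hz] at h1
    have h2 : φ z ^ 2 ≠ 0 := pow_ne_zero 2 (hpos _).ne'
    rw [eq_mul_inv_iff_mul_eq₀ h2]
    exact eq_sub_of_add_eq h1
  refine (d3.congr_of_eventuallyEq e).congr_fderiv ?_
  ext u
  -- From ∇_u grad f = -k f u one gets d‖grad f‖²(u) = -2 k f df(u). This contributes 2k df/f to the
  -- derivative of (c - ‖grad f‖²)/f², while differentiating 1/f² contributes -2k df/f.
  have h3 := hG.fderiv_gradient_normSq hx hs u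
  have h4 : Coord.nabla (g.coeff x) (fun _ => u) (Coord.gradient (g.coeff x) φ) y = _ :=
    g.hessianOp_eq_of_hessian (hpos x).ne' (hH x) u
  rw [h4, map_smul, smul_apply, hG.symm y hx u, hG.apply_gradient hx] at h3
  have h5 := e.self_of_nhds
  rw [eq_mul_inv_iff_mul_eq₀ hne, Function.comp_apply, hy, extChartAt_to_inv, ← hy] at h5
  rw [← hφy] at h3
  simp [h3, ← h5]
  have hφ0 : φ y ≠ 0 := by rw [hφy]; exact (hpos x).ne'
  field_simp
  ring

end

/-! ### Pointwise splitting of the curvature condition -/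

section Warped

variable {E₁ : Type*} [NormedAddCommGroup E₁] [NormedSpace ℝ E₁] [FiniteDimensional ℝ E₁]
  {E₂ : Type*} [NormedAddCommGroup E₂] [NormedSpace ℝ E₂] [FiniteDimensional ℝ E₂]
  {M₁ : Type*} [TopologicalSpace M₁] [ChartedSpace E₁ M₁] [IsManifold 𝓘(ℝ, E₁) ∞ M₁]
  {M₂ : Type*} [TopologicalSpace M₂] [ChartedSpace E₂ M₂] [IsManifold 𝓘(ℝ, E₂) ∞ M₂]
  (g₁ : PseudoRiemannianMetric 𝓘(ℝ, E₁) M₁) (g₂ : PseudoRiemannianMetric 𝓘(ℝ, E₂) M₂)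
  {f : M₁ → ℝ} (hf : ContMDiff 𝓘(ℝ, E₁) 𝓘(ℝ, ℝ) ∞ f) (hpos : ∀ p, 0 < f p)

theorem isWarpedOn_coeff (x : M₁ × M₂) :
    Coord.IsWarpedOn ((warpedProduct g₁ g₂ f hf hpos).coeff x)
      (extChartAt (𝓘(ℝ, E₁).prod 𝓘(ℝ, E₂)) x).target
      (g₁.coeff x.1) (extChartAt 𝓘(ℝ, E₁) x.1).target (f ∘ (extChartAt 𝓘(ℝ, E₁) x.1).symm)
      (g₂.coeff x.2) (extChartAt 𝓘(ℝ, E₂) x.2).target := by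
  have hsub : (extChartAt (𝓘(ℝ, E₁).prod 𝓘(ℝ, E₂)) x).target ⊆
      (extChartAt 𝓘(ℝ, E₁) x.1).target ×ˢ (extChartAt 𝓘(ℝ, E₂) x.2).target := by
    rw [extChartAt_prod]; exact subset_rfl
  have heq (y : E₁ × E₂) (hy : y ∈ (extChartAt (𝓘(ℝ, E₁).prod 𝓘(ℝ, E₂)) x).target) :
      (warpedProduct g₁ g₂ f hf hpos).coeff x y = orthSum (g₁.coeff x.1 y.1)
        ((f ∘ (extChartAt 𝓘(ℝ, E₁) x.1).symm) y.1 ^ 2) (g₂.coeff x.2 y.2) :=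
    chartCoeff_warpedForm g₁ g₂ f x y hy
  have happ (y : E₁ × E₂) (hy : y ∈ (extChartAt (𝓘(ℝ, E₁).prod 𝓘(ℝ, E₂)) x).target)
      (u v : E₁ × E₂) : (warpedProduct g₁ g₂ f hf hpos).coeff x y u v =
        g₁.coeff x.1 y.1 u.1 v.1 +
          (f ∘ (extChartAt 𝓘(ℝ, E₁) x.1).symm) y.1 ^ 2 * g₂.coeff x.2 y.2 u.2 v.2 := by
    rw [heq y hy]; rfl
  refine ⟨⟨isOpen_extChartAt_target x, (warpedProduct g₁ g₂ f hf hpos).smooth x, ?_, ?_⟩,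
    g₁.isMetricOn_coeff x.1, g₂.isMetricOn_coeff x.2, contDiffOn_comp_extChartAt_symm hf x.1,
    fun y _ => (hpos _).ne', hsub, heq⟩
  · intro y hy u v
    rw [happ y hy, happ y hy, (g₁.isMetricOn_coeff x.1).symm _ (hsub hy).1,
      (g₂.isMetricOn_coeff x.2).symm _ (hsub hy).2]
  · intro y hy
    refine Coord.isInvertible_of_nondegenerate _ fun u hu => Prod.ext ?_ ?_
    · refine (g₁.isMetricOn_coeff x.1).eq_of_apply_eq (hsub hy).1 fun w => ?_
      have := hu (w, 0)
      rw [happ y hy] at this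
      simpa using this
    · refine (g₂.isMetricOn_coeff x.2).eq_of_apply_eq (hsub hy).2 fun w => ?_
      have := hu (0, w)
      rw [happ y hy] at this
      simpa [(hpos _).ne'] using this

/-- The curvature of a warped product. -/
theorem riemann_warpedProduct (p : M₁) (q : M₂) (u v w : E₁ × E₂) :
    (show E₁ × E₂ from (warpedProduct g₁ g₂ f hf hpos).riemann (p, q) u v w) =
      (g₁.curv p u.1 v.1 w.1 - (f p * g₂.form q u.2 w.2) • g₁.hessianOp f p v.1
          + (f p * g₂.form q v.2 w.2) • g₁.hessianOp f p u.1,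
        g₂.curv q u.2 v.2 w.2
          - g₁.gradNormSq f p • (g₂.form q u.2 w.2 • v.2 - g₂.form q v.2 w.2 • u.2)
          - (1 / f p) • (g₁.form p (g₁.hessianOp f p u.1) w.1 • v.2
            - g₁.form p (g₁.hessianOp f p v.1) w.1 • u.2)) := by
  have : CompleteSpace E₁ := FiniteDimensional.complete ℝ E₁
  have : CompleteSpace E₂ := FiniteDimensional.complete ℝ E₂
  have h := (isWarpedOn_coeff g₁ g₂ hf hpos (p, q)).curvature_eq (mem_extChartAt_target (p, q)) u v w
  have h1 : (extChartAt (𝓘(ℝ, E₁).prod 𝓘(ℝ, E₂)) (p, q) (p, q)).1 = extChartAt 𝓘(ℝ, E₁) p p := by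
    rw [extChartAt_prod]; rfl
  have h2 : (extChartAt (𝓘(ℝ, E₁).prod 𝓘(ℝ, E₂)) (p, q) (p, q)).2 = extChartAt 𝓘(ℝ, E₂) q q := by
    rw [extChartAt_prod]; rfl
  rw [h1, h2, Function.comp_apply, extChartAt_to_inv, g₁.coeff_self, g₂.coeff_self] at h
  exact h

/-- The curvature of a warped product at a point is that of a space form of curvature `k` if and
only if the three components of the curvature are. -/
theorem riemann_warpedProduct_eq_iff [Nontrivial E₂] (p : M₁) (q : M₂) (k : ℝ) :
    (∀ u v w : E₁ × E₂, (show E₁ × E₂ from (warpedProduct g₁ g₂ f hf hpos).riemann (p, q) u v w) =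
      k • ((g₁.form p u.1 w.1 + f p ^ 2 * g₂.form q u.2 w.2) • v
        - (g₁.form p v.1 w.1 + f p ^ 2 * g₂.form q v.2 w.2) • u)) ↔
    (∀ u v w : E₁, g₁.curv p u v w = k • (g₁.form p u w • v - g₁.form p v w • u)) ∧
    (∀ u v : E₁, 1 / f p * g₁.form p (g₁.hessianOp f p u) v + k * g₁.form p u v = 0) ∧
    (∀ u v w : E₂, g₂.curv q u v w = (k * f p ^ 2 + g₁.gradNormSq f p) •
      (g₂.form q u w • v - g₂.form q v w • u)) := by
  have hp := (hpos p).ne'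
  simp only [riemann_warpedProduct]
  constructor
  · intro h
    -- The three conditions are read off from purely horizontal, mixed and purely vertical
    -- arguments; the mixed case needs a nonzero vector `b` tangent to the fiber.
    refine ⟨fun u v w => ?_, fun u v => ?_, fun u v w => ?_⟩
    · simpa using congrArg Prod.fst (h (u, 0) (v, 0) (w, 0))
    · obtain ⟨b, hb⟩ := exists_ne (0 : E₂)
      have h1 := congrArg Prod.snd (h (u, 0) (0, b) (v, 0))
      have h0 : g₂.curv q 0 b 0 = 0 := Coord.curvature_const_zero _ _ _ _
      simp [h0] at h1
      rw [smul_smul, smul_smul, ← sub_eq_zero, ← neg_smul, ← sub_smul] at h1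
      have h2 := (smul_eq_zero.1 h1).resolve_right hb
      rw [one_div]
      linarith
    · have h1 := congrArg Prod.snd (h (0, u) (0, v) (0, w))
      simp at h1
      rw [sub_eq_iff_eq_add] at h1
      rw [h1]
      module
  · rintro ⟨hA, hB, hC⟩ u v w
    -- The operator form turns -f g₂(u, w) ∇_v grad f into k f² g₂(u, w) v, and the ‖grad f‖² terms
    -- cancel against the fiber curvature.
    have hH := g₁.hessianOp_eq_of_hessian hp hB
    refine Prod.ext ?_ ?_
    · simp only [hA, hH, Prod.smul_fst, Prod.fst_sub]
      module
    · simp only [hC, hH, Prod.smul_snd, Prod.snd_sub, map_smul, smul_apply, smul_eq_mul]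
      match_scalars <;> field_simp
      all_goals ring

end Warped

end PseudoRiemannianMetric

end

/-! ### The characterization of concircular flatness -/

theorem mainTheorem1
    {E₁ : Type*} [NormedAddCommGroup E₁] [NormedSpace ℝ E₁] [FiniteDimensional ℝ E₁]
    {E₂ : Type*} [NormedAddCommGroup E₂] [NormedSpace ℝ E₂] [FiniteDimensional ℝ E₂]
    {M₁ : Type*} [TopologicalSpace M₁] [ChartedSpace E₁ M₁] [IsManifold 𝓘(ℝ, E₁) ∞ M₁]
    [ConnectedSpace M₁]
    {M₂ : Type*} [TopologicalSpace M₂] [ChartedSpace E₂ M₂] [IsManifold 𝓘(ℝ, E₂) ∞ M₂]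
    [ConnectedSpace M₂]
    (g₁ : PseudoRiemannianMetric 𝓘(ℝ, E₁) M₁) (g₂ : PseudoRiemannianMetric 𝓘(ℝ, E₂) M₂)
    (f : M₁ → ℝ) (hf : ContMDiff 𝓘(ℝ, E₁) 𝓘(ℝ, ℝ) ∞ f) (hpos : ∀ p, 0 < f p)
    (h₁ : 2 ≤ finrank ℝ E₁) (h₂ : 2 ≤ finrank ℝ E₂) :
    (warpedProduct g₁ g₂ f hf hpos).IsConcircularlyFlat ↔
      ∃ κ : ℝ,
        (∀ x : M₁ × M₂, (warpedProduct g₁ g₂ f hf hpos).scalarCurvature x /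
          (((finrank ℝ E₁ : ℝ) + finrank ℝ E₂) * ((finrank ℝ E₁ : ℝ) + finrank ℝ E₂ - 1)) = κ) ∧
        g₁.HasConstantCurvature κ ∧
        (∀ (p : M₁) (u v : TangentSpace 𝓘(ℝ, E₁) p),
          1 / f p * g₁.hessian f p u v + κ * g₁.toFun p u v = 0) ∧
        ∃ κ₂ : ℝ, (∀ p : M₁, κ₂ = κ * f p ^ 2 + g₁.gradNormSq f p) ∧
          g₂.HasConstantCurvature κ₂ := by
  have hE₂ : Nontrivial E₂ := Module.nontrivial_of_finrank_pos (R := ℝ) (by omega)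
  set g := warpedProduct g₁ g₂ f hf hpos
  have hn (x : M₁ × M₂) : g.scalarCurvature x / (((finrank ℝ E₁ : ℝ) + finrank ℝ E₂) *
      ((finrank ℝ E₁ : ℝ) + finrank ℝ E₂ - 1)) = g.normalizedScalarCurvature x := by
    unfold PseudoRiemannianMetric.normalizedScalarCurvature
    rw [finrank_prod]; push_cast; rfl
  have key : g.IsConcircularlyFlat ↔ ∀ p q,
      (∀ u v w : E₁, g₁.curv p u v w = g.normalizedScalarCurvature (p, q) •
        (g₁.form p u w • v - g₁.form p v w • u)) ∧
      (∀ u v : E₁, 1 / f p * g₁.form p (g₁.hessianOp f p u) v +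
        g.normalizedScalarCurvature (p, q) * g₁.form p u v = 0) ∧
      (∀ u v w : E₂, g₂.curv q u v w =
        (g.normalizedScalarCurvature (p, q) * f p ^ 2 + g₁.gradNormSq f p) •
          (g₂.form q u w • v - g₂.form q v w • u)) := by
    constructor
    · intro h p q
      rw [← g₁.riemann_warpedProduct_eq_iff g₂ hf hpos p q]
      exact fun u v w => sub_eq_zero.1 (h (p, q) u v w)
    · rintro h ⟨p, q⟩ u v w
      have h1 := (g₁.riemann_warpedProduct_eq_iff g₂ hf hpos p q _).2 (h p q) u v w
      exact sub_eq_zero.2 h1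
  rw [key]
  simp only [hn]
  constructor
  · intro h
    obtain ⟨p₀⟩ : Nonempty M₁ := inferInstance
    obtain ⟨q₀⟩ : Nonempty M₂ := inferInstance
    -- The curvature of M₁ at `p` does not involve `q`, so two factors fitting it agree.
    have hfib (p : M₁) (q : M₂) :
        g.normalizedScalarCurvature (p, q) = g.normalizedScalarCurvature (p, q₀) :=
      eq_of_smul_curvatureForm_eq (g₁.form p) (fun _ => g₁.form_nondegenerate p) h₁
        fun u v w => ((h p q).1 u v w).symm.trans ((h p q₀).1 u v w)
    -- Dually, the curvature of M₂ at `q₀` does not involve `p`.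
    have hc (p : M₁) : g.normalizedScalarCurvature (p, q₀) * f p ^ 2 + g₁.gradNormSq f p =
        g.normalizedScalarCurvature (p₀, q₀) * f p₀ ^ 2 + g₁.gradNormSq f p₀ :=
      eq_of_smul_curvatureForm_eq (g₂.form q₀) (fun _ => g₂.form_nondegenerate q₀) h₂
        fun u v w => ((h p q₀).2.2 u v w).symm.trans ((h p₀ q₀).2.2 u v w)
    have hk (p : M₁) :
        g.normalizedScalarCurvature (p, q₀) = g.normalizedScalarCurvature (p₀, q₀) :=
      g₁.apply_eq_of_hessian_eq (k := fun p => g.normalizedScalarCurvature (p, q₀)) hf hpos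
        (fun p => (h p q₀).2.1) hc p p₀
    refine ⟨g.normalizedScalarCurvature (p₀, q₀), fun x => (hfib x.1 x.2).trans (hk x.1),
      fun p u v w => ?_, fun p u v => ?_,
      g.normalizedScalarCurvature (p₀, q₀) * f p₀ ^ 2 + g₁.gradNormSq f p₀, fun p => ?_,
      fun q u v w => ?_⟩
    · rw [← hk p]
      exact (h p q₀).1 u v w
    · rw [← hk p]
      exact (h p q₀).2.1 u v
    · rw [← hc p, hk p]
    · have h1 := (h p₀ q).2.2 u v w
      rw [hfib p₀ q] at h1
      exact h1
  · rintro ⟨κ, hκ, hA, hB, κ₂, hκ₂, hC⟩ p q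
    -- `hκ` identifies the factor at each point with κ, so the converse needs no trace of the
    -- curvature.
    rw [hκ (p, q), ← hκ₂ p]
    exact ⟨hA p, hB p, hC q⟩
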